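/- For a subset $A$ of a finite abelian group $G$, let $S_A=\{\sum_{a\in B}a : B\subseteq A \text{ finite}\}$ be the set of its subset sums. Call $A$ incomplete if $S_A\neq G$, and nice if there is a subgroup $H\le G$ such that $|G/H|$ is a prime and $S_{A\cap H}=H$. (i) For every $\delta>0$ there is $D(\delta)>0$ such that the following holds. Let $p_1\le p_2\le\dots\le p_t$, $t\ge 3$, be primes, let $n=\prod_{i=1}^t p_i$, and suppose that $$p_1p_2\le \frac{1}{D(\delta)}\sqrt{\frac{n}{\log n}} .$$ Then every incomplete subset $A$ of an abelian group $G$ of order $n$ with $|A|\ge(1+\delta)\frac{n}{p_1p_2}$ is nice. (ii) The lower bound $(1+\delta)\frac{n}{p_1p_2}$ in (i) cannot be replaced by $\frac{n}{p_1p_2}+n^{1/4-\alpha}$ for any constant $\alpha>0$: for all $\alpha>0$ and $D>0$ there are primes $p<q$ such that, with $n=p^2q$ (so that $t=3$, $p_1=p_2=p$, $p_3=q$), one has $p_1p_2=p^2\le\frac1D\sqrt{n/\log n}$, and the group $\mathbb Z_{p^2}\oplus\mathbb Z_q$ contains an incomplete set $A$ with $|A|\ge\frac{n}{p^2}+n^{1/4-\alpha}$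 that is not nice. Both parts hold whether the empty subset $B=\emptyset$ (with sum $0$) is admitted in the definition of $S_A$ or excluded from it, the same convention being used for "incomplete" and for "nice". -/

import Mathlib

universe u

/-- The set `S_A` of all sums `∑_{a ∈ B} a` over finite `B ⊆ A`. The flag says whether the
empty set `B` (with sum `0`) is admitted. -/
def subsetSums {G : Type*} [AddCommGroup G] (allowEmpty : Bool) (A : Set G) : Set G :=
  {x | ∃ B : Finset G, (allowEmpty = true ∨ B.Nonempty) ∧ (B : Set G) ⊆ A ∧ ∑ b ∈ B, b = x}

/-- `A` is incomplete if `S_A` is not all of `G`. -/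
def IsIncomplete {G : Type*} [AddCommGroup G] (allowEmpty : Bool) (A : Set G) : Prop :=
  subsetSums allowEmpty A ≠ Set.univ

/-- `A` is nice if `S_{A ∩ H} = H` for some subgroup `H` such that `|G/H|` is a prime. -/
def IsNice {G : Type*} [AddCommGroup G] (allowEmpty : Bool) (A : Set G) : Prop :=
  ∃ H : AddSubgroup G, (Nat.card (G ⧸ H)).Prime ∧
    subsetSums allowEmpty (A ∩ (H : Set G)) = (H : Set G)

open scoped Pointwise

/-- Hamidoune's isoperimetric inequality: translating by a generating set `Y ∋ 0` enlarges a set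
by at least `|Y| / 2`, unless everything is covered. -/
theorem two_mul_card_add_card_le_of_closure_eq_top {G : Type*} [AddCommGroup G] [Fintype G]
    [DecidableEq G] {Y : Finset G} (h0 : (0 : G) ∈ Y)
    (hgen : AddSubgroup.closure (Y : Set G) = ⊤) {S : Finset G} (hS : S.Nonempty)
    (hne : S + Y ≠ Finset.univ) : 2 * S.card + Y.card ≤ 2 * (S + Y).card := by
  classical
  have hmono : ∀ F : Finset G, F ⊆ F + Y := fun F => Finset.subset_add_left F h0
  have hle : ∀ F : Finset G, F.card ≤ (F + Y).card := fun F => Finset.card_le_card (hmono F)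
  let 𝓕 : Finset (Finset G) := Finset.univ.filter fun F => F.Nonempty ∧ F + Y ≠ Finset.univ
  have h𝓕 : ∀ F, F ∈ 𝓕 ↔ F.Nonempty ∧ F + Y ≠ Finset.univ := fun F => by simp [𝓕]
  obtain ⟨F₀, hF₀, hmin₀⟩ := Finset.exists_min_image 𝓕 (fun F => (F + Y).card - F.card)
    ⟨S, (h𝓕 S).2 ⟨hS, hne⟩⟩
  obtain ⟨κ, hκ⟩ : ∃ κ, κ = (F₀ + Y).card - F₀.card := ⟨_, rfl⟩
  rw [← hκ] at hmin₀
  have hlow : ∀ F : Finset G, F.Nonempty → F + Y ≠ Finset.univ → F.card + κ ≤ (F + Y).card := by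
    intro F h1 h2
    have := hmin₀ F ((h𝓕 F).2 ⟨h1, h2⟩)
    have := hle F
    omega
  let 𝓐 : Finset (Finset G) := 𝓕.filter fun F => (F + Y).card = F.card + κ
  have h𝓐 : ∀ F, F ∈ 𝓐 ↔ (F.Nonempty ∧ F + Y ≠ Finset.univ) ∧ (F + Y).card = F.card + κ :=
    fun F => by simp [𝓐, h𝓕]
  obtain ⟨F₁, hF₁, hmin₁⟩ := Finset.exists_min_image 𝓐 Finset.card
    ⟨F₀, (h𝓐 F₀).2 ⟨(h𝓕 F₀).1 hF₀, by have := hle F₀; omega⟩⟩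
  have htr : ∀ F ∈ 𝓐, ∀ g : G, g +ᵥ F ∈ 𝓐 := by
    intro F hF g
    obtain ⟨⟨h1, h2⟩, h3⟩ := (h𝓐 F).1 hF
    have hv : (g +ᵥ F) + Y = g +ᵥ (F + Y) := vadd_add_assoc g F Y
    refine (h𝓐 _).2 ⟨⟨h1.vadd_finset, fun h => h2 ?_⟩, ?_⟩
    · rw [← Finset.card_eq_iff_eq_univ] at h ⊢
      rwa [hv, Finset.card_vadd_finset] at h
    · rw [hv, Finset.card_vadd_finset, Finset.card_vadd_finset, h3]
  obtain ⟨f, hf⟩ := ((h𝓐 F₁).1 hF₁).1.1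
  obtain ⟨F, hFdef⟩ : ∃ F, F = -f +ᵥ F₁ := ⟨_, rfl⟩
  have hFA : F ∈ 𝓐 := hFdef ▸ htr F₁ hF₁ _
  have hFmin : ∀ F' ∈ 𝓐, F.card ≤ F'.card := by
    intro F' h
    rw [hFdef, Finset.card_vadd_finset]
    exact hmin₁ F' h
  have hF0 : (0 : G) ∈ F := by
    rw [hFdef, Finset.mem_vadd_finset]
    exact ⟨f, hf, by simp⟩
  obtain ⟨⟨hFne, hFu⟩, hFc⟩ := (h𝓐 F).1 hFA
  have hdual : 2 * F.card + κ ≤ Fintype.card G := by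
    have hW : (-(F + Y)ᶜ).Nonempty := by
      rw [Finset.neg_nonempty_iff, Finset.nonempty_iff_ne_empty, Ne, Finset.compl_eq_empty_iff]
      exact hFu
    have hsub : -(F + Y)ᶜ + Y ⊆ (-F)ᶜ := by
      intro x hx
      obtain ⟨w, hw, y, hy, rfl⟩ := Finset.mem_add.1 hx
      rw [Finset.mem_neg'] at hw
      rw [Finset.mem_compl] at hw ⊢
      refine fun h => hw ?_
      rw [Finset.mem_neg'] at h
      exact Finset.mem_add.2 ⟨_, h, y, hy, by abel⟩
    have hWc : (-(F + Y)ᶜ).card = Fintype.card G - (F + Y).card := by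
      rw [Finset.card_neg, Finset.card_compl]
    have hsubc := Finset.card_le_card hsub
    rw [Finset.card_compl, Finset.card_neg] at hsubc
    have hF1 := hFne.card_pos
    have hF2 := (F + Y).card_le_univ
    have hWu : -(F + Y)ᶜ + Y ≠ Finset.univ := fun h => by
      rw [h, Finset.card_univ] at hsubc
      omega
    have h1 := hlow _ hW hWu
    have h2 := hFmin _ ((h𝓐 _).2 ⟨⟨hW, hWu⟩, by omega⟩)
    omega
  have habs : ∀ g : G, (F ∩ (g +ᵥ F)).Nonempty → g +ᵥ F = F := by
    intro g hI
    obtain ⟨⟨-, h2u⟩, h2c⟩ := (h𝓐 _).1 (htr F hFA g)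
    have hcard : (g +ᵥ F).card = F.card := Finset.card_vadd_finset g F
    have hIsub : (F ∩ (g +ᵥ F)) + Y ⊆ (F + Y) ∩ ((g +ᵥ F) + Y) := Finset.inter_add_subset
    have hU : (F ∪ (g +ᵥ F)) + Y = (F + Y) ∪ ((g +ᵥ F) + Y) := Finset.union_add
    have hIu : (F ∩ (g +ᵥ F)) + Y ≠ Finset.univ := fun h => hFu <| by
      rw [h] at hIsub
      exact Finset.univ_subset_iff.1 (hIsub.trans Finset.inter_subset_left)
    have e1 := Finset.card_union_add_card_inter (F + Y) ((g +ᵥ F) + Y)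
    have e2 := Finset.card_union_add_card_inter F (g +ᵥ F)
    have e3 := Finset.card_le_card hIsub
    have e4 := hlow _ hI hIu
    have hIpos := hI.card_pos
    rw [← hU] at e1
    have hUu : (F ∪ (g +ᵥ F)) + Y ≠ Finset.univ := fun h => by
      have := Finset.card_univ (α := G)
      rw [← h] at this
      omega
    have e5 := hlow _ (hFne.mono Finset.subset_union_left) hUu
    have e6 := hFmin _ ((h𝓐 _).2 ⟨⟨hI, hIu⟩, by omega⟩)
    have e7 : F ∩ (g +ᵥ F) = F := Finset.eq_of_subset_of_card_le Finset.inter_subset_left e6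
    exact (Finset.eq_of_subset_of_card_le (Finset.inter_eq_left.1 e7) hcard.le).symm
  have hstab : ∀ a ∈ F, a +ᵥ F = F := fun a ha => habs a
    ⟨a, Finset.mem_inter.2 ⟨ha, Finset.mem_vadd_finset.2 ⟨0, hF0, by simp⟩⟩⟩
  let K : AddSubgroup G :=
    { carrier := F
      zero_mem' := hF0
      add_mem' := fun {a b} ha hb => by
        have : a +ᵥ b ∈ a +ᵥ F := Finset.vadd_mem_vadd_finset hb
        rw [hstab a ha] at this
        exact this
      neg_mem' := fun {a} ha => by
        have h : (0 : G) ∈ a +ᵥ F := by rw [hstab a ha]; exact hF0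
        obtain ⟨b, hb, hab⟩ := Finset.mem_vadd_finset.1 h
        rw [neg_eq_of_add_eq_zero_right hab]
        exact hb }
  obtain ⟨y, hy, hyF⟩ : ∃ y ∈ Y, y ∉ F := by
    by_contra! h
    have : K = ⊤ := top_le_iff.1 (hgen ▸ (AddSubgroup.closure_le K).2 h)
    refine hFu (Finset.univ_subset_iff.1 fun x _ => hmono F ?_)
    exact (this ▸ AddSubgroup.mem_top x : x ∈ K)
  have hdisj : Disjoint F (y +ᵥ F) := by
    rw [Finset.disjoint_left]
    intro x hx hx'
    obtain ⟨b, hb, rfl⟩ := Finset.mem_vadd_finset.1 hx'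
    exact hyF ((K.add_mem_cancel_right (show b ∈ K from hb)).1 hx)
  have h2F : 2 * F.card ≤ (F + Y).card := by
    have h : F ∪ (y +ᵥ F) ⊆ F + Y := Finset.union_subset (hmono F) fun x hx => by
      obtain ⟨b, hb, rfl⟩ := Finset.mem_vadd_finset.1 hx
      exact Finset.mem_add.2 ⟨b, hb, y, hy, add_comm b y⟩
    have := Finset.card_le_card h
    rw [Finset.card_union_of_disjoint hdisj, Finset.card_vadd_finset] at this
    omega
  have hYle : Y.card ≤ (F + Y).card := Finset.card_le_card (Finset.subset_add_right Y hF0)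
  have := hlow S hS hne
  omega

theorem iterate_add_eq_univ_of_closure_eq_top {G : Type*} [AddCommGroup G] [Fintype G]
    [DecidableEq G] {Y : Finset G} (h0 : (0 : G) ∈ Y)
    (hgen : AddSubgroup.closure (Y : Set G) = ⊤) {l : ℕ}
    (hl : 2 * Fintype.card G ≤ l * Y.card) : (· + Y)^[l] {0} = Finset.univ := by
  by_contra hne
  have hu : ∀ i j, i + j = l → (· + Y)^[i] {0} ≠ Finset.univ := by
    rintro i j rfl h
    apply hne
    rw [add_comm, Function.iterate_add_apply, h]
    clear * - h0
    induction j with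
    | zero => rfl
    | succ j ih =>
      rw [Function.iterate_succ_apply', ih]
      exact Finset.univ_subset_iff.1 (Finset.subset_add_left _ h0)
  have key : ∀ i ≤ l, 2 + i * Y.card ≤ 2 * ((· + Y)^[i] {0}).card := by
    intro i hi
    induction i with
    | zero => simp
    | succ i ih =>
      have h1 := ih (by omega)
      have h2 : (· + Y)^[i + 1] {0} = (· + Y)^[i] {0} + Y := Function.iterate_succ_apply' _ _ _
      have h3 := two_mul_card_add_card_le_of_closure_eq_top h0 hgen
        (S := (· + Y)^[i] {0}) (Finset.card_pos.1 (by omega))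
        (h2 ▸ hu (i + 1) (l - (i + 1)) (by omega))
      rw [h2, add_one_mul]
      omega
  have h1 := key l le_rfl
  have := Finset.card_le_univ ((· + Y)^[l] {0})
  omega

theorem mem_iterate_add_of_mem_closure {G : Type*} [AddCommGroup G] [Fintype G]
    [DecidableEq G] {Y : Finset G} (h0 : (0 : G) ∈ Y) {l : ℕ}
    (hl : 2 * Fintype.card G ≤ l * Y.card) {h : G}
    (hh : h ∈ AddSubgroup.closure (Y : Set G)) : h ∈ (· + Y)^[l] {0} := by
  classical
  let H := AddSubgroup.closure (Y : Set G)
  have hYH : ∀ y ∈ Y, y ∈ H := fun y hy => AddSubgroup.subset_closure hy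
  let Z : Finset H := Finset.univ.filter fun z => (z : G) ∈ Y
  have hZ : ∀ z : H, z ∈ Z ↔ (z : G) ∈ Y := fun z => by simp [Z]
  have hZc : Z.card = Y.card := by
    rw [← Finset.card_map (Function.Embedding.subtype _)]
    congr 1
    ext y
    simp only [Finset.mem_map, hZ, Function.Embedding.subtype_apply]
    exact ⟨by rintro ⟨z, hz, rfl⟩; exact hz, fun hy => ⟨⟨y, hYH y hy⟩, hy, rfl⟩⟩
  have hgen : AddSubgroup.closure (Z : Set H) = ⊤ := by
    rw [← AddSubgroup.closure_closure_coe_preimage (k := (Y : Set G))]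
    congr 1
    ext z
    exact hZ z
  have hcard : Fintype.card H ≤ Fintype.card G :=
    Fintype.card_le_of_injective _ Subtype.val_injective
  have hu := iterate_add_eq_univ_of_closure_eq_top ((hZ 0).2 h0) hgen (l := l)
    (by rw [hZc]; omega)
  have himg : ∀ i, ∀ z ∈ (· + Z)^[i] {0}, (z : G) ∈ (· + Y)^[i] {0} := by
    intro i
    induction i with
    | zero => simp
    | succ i ih =>
      intro z hz
      rw [Function.iterate_succ_apply'] at hz ⊢
      obtain ⟨w, hw, y, hy, rfl⟩ := Finset.mem_add.1 hz
      exact Finset.mem_add.2 ⟨w, ih w hw, y, (hZ y).1 hy, rfl⟩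
  exact himg l ⟨h, hh⟩ (hu ▸ Finset.mem_univ _)

/-- The number of `a ∈ A` that are a summand of `x` as a sum of two distinct elements of `A`. -/
def pairCount {G : Type*} [AddCommGroup G] [DecidableEq G] (A : Finset G) (x : G) : ℕ :=
  (A.filter fun a => x - a ∈ A ∧ x - a ≠ a).card

theorem exists_sum_eq_of_le_pairCount {G : Type*} [AddCommGroup G] [DecidableEq G]
    {A X : Finset G} {t l : ℕ} (hX : ∀ x ∈ X, t ≤ pairCount A x) (hl : 4 * l < t + 4) (x₀ : G)
    {y : G} (hy : y ∈ (· + X.image (· - x₀))^[l] {0}) :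
    ∃ B ⊆ A, B.card = 2 * l ∧ ∑ b ∈ B, b = l • x₀ + y := by
  induction l generalizing y with
  | zero =>
    refine ⟨∅, by simp, by simp, ?_⟩
    simpa [eq_comm] using hy
  | succ l ih =>
    rw [Function.iterate_succ_apply'] at hy
    obtain ⟨y', hy', z, hz, rfl⟩ := Finset.mem_add.1 hy
    obtain ⟨x, hx, rfl⟩ := Finset.mem_image.1 hz
    obtain ⟨B, hBA, hBc, hBs⟩ := ih (by omega) hy'
    have hlt : (B ∪ B.image (x - ·)).card < pairCount A x := by
      have h1 := Finset.card_union_le B (B.image (x - ·))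
      have h2 : (B.image (x - ·)).card ≤ B.card := Finset.card_image_le
      have h3 := hX x hx
      omega
    obtain ⟨a, ha, hab⟩ := Finset.exists_mem_notMem_of_card_lt_card hlt
    obtain ⟨haA, hxA, hne⟩ := by simpa only [Finset.mem_filter] using ha
    rw [Finset.mem_union, not_or] at hab
    have hxB : x - a ∉ B := fun h => hab.2 (Finset.mem_image.2 ⟨_, h, by abel⟩)
    have hxB' : x - a ∉ insert a B := by
      rw [Finset.mem_insert, not_or]
      exact ⟨hne, hxB⟩
    refine ⟨insert (x - a) (insert a B), ?_, ?_, ?_⟩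
    · exact Finset.insert_subset hxA (Finset.insert_subset haA hBA)
    · rw [Finset.card_insert_of_notMem hxB', Finset.card_insert_of_notMem hab.1, hBc]
      ring
    · rw [Finset.sum_insert hxB', Finset.sum_insert hab.1, hBs, add_smul, one_smul]
      abel

theorem sum_pairCount {G : Type*} [AddCommGroup G] [Fintype G] [DecidableEq G] (A : Finset G) :
    ∑ x, pairCount A x = A.card * A.card - A.card := by
  have h : A.offDiag.card = ∑ x, pairCount A x := by
    rw [Finset.card_eq_sum_card_fiberwise (f := fun q : G × G => q.1 + q.2) (t := Finset.univ)
      (by simp)]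
    refine Finset.sum_congr rfl fun x _ => ?_
    refine Finset.card_bij (fun q _ => q.1) ?_ ?_ ?_
    · rintro ⟨a, b⟩ hq
      simp only [Finset.mem_filter, Finset.mem_offDiag] at hq ⊢
      obtain ⟨⟨ha, hb, hab⟩, rfl⟩ := hq
      simpa [ha, hb] using Ne.symm hab
    · rintro ⟨a, b⟩ hq ⟨a', b'⟩ hq' h
      simp only [Finset.mem_filter] at hq hq' h
      subst h
      rw [Prod.mk.injEq]
      exact ⟨rfl, add_left_cancel (hq.2.trans hq'.2.symm)⟩
    · intro a ha
      simp only [Finset.mem_filter] at ha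
      refine ⟨(a, x - a), ?_, rfl⟩
      simp only [Finset.mem_filter, Finset.mem_offDiag]
      exact ⟨⟨ha.1, ha.2.1, Ne.symm ha.2.2⟩, by abel⟩
  rw [← h, Finset.offDiag_card]

/-- By pigeonhole against the harmonic sum, some level set of `pairCount` is large. -/
theorem exists_level_pairCount {G : Type*} [AddCommGroup G] [Fintype G] [DecidableEq G]
    (A : Finset G) (hA : 2 ≤ A.card) : ∃ t : ℕ, 1 ≤ t ∧ t ≤ A.card ∧
      (A.card : ℝ) ^ 2 / 2 ≤
        t * (Finset.univ.filter fun x => t ≤ pairCount A x).card * (1 + Real.log A.card) := by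
  by_contra! hcon
  set m := A.card with hm
  have hm2 : (2 : ℝ) ≤ m := by exact_mod_cast hA
  have hlog : 0 ≤ Real.log m := Real.log_nonneg (by linarith)
  have hsum : (∑ x, pairCount A x : ℕ) =
      ∑ t ∈ Finset.Icc 1 m, (Finset.univ.filter fun x => t ≤ pairCount A x).card := by
    simp_rw [Finset.card_filter]
    rw [Finset.sum_comm]
    refine Finset.sum_congr rfl fun x _ => ?_
    have hle : pairCount A x ≤ m := Finset.card_filter_le _ _
    rw [← Finset.card_filter]
    have : (Finset.Icc 1 m).filter (fun t => t ≤ pairCount A x) =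
        Finset.Icc 1 (pairCount A x) := by
      ext t
      simp only [Finset.mem_filter, Finset.mem_Icc]
      omega
    rw [this]
    simp
  have h1 : ((∑ x, pairCount A x : ℕ) : ℝ) <
      ∑ t ∈ Finset.Icc 1 m, (m : ℝ) ^ 2 / 2 / (1 + Real.log m) * (t : ℝ)⁻¹ := by
    rw [hsum, Nat.cast_sum]
    refine Finset.sum_lt_sum_of_nonempty ⟨1, Finset.mem_Icc.2 ⟨le_rfl, by omega⟩⟩ fun t ht => ?_
    obtain ⟨ht1, ht2⟩ := Finset.mem_Icc.1 ht
    have ht0 : (0 : ℝ) < t := by exact_mod_cast ht1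
    have := hcon t ht1 ht2
    rw [← div_eq_mul_inv, lt_div_iff₀ ht0, lt_div_iff₀ (by linarith)]
    linarith
  have h2 : ∑ t ∈ Finset.Icc 1 m, (t : ℝ)⁻¹ ≤ 1 + Real.log m := by
    have := harmonic_le_one_add_log m
    rw [harmonic_eq_sum_Icc] at this
    push_cast at this
    exact this
  rw [← Finset.mul_sum, sum_pairCount, Nat.cast_sub (Nat.le_mul_self _)] at h1
  have h3 : (m : ℝ) ^ 2 / 2 / (1 + Real.log m) * ∑ t ∈ Finset.Icc 1 m, (t : ℝ)⁻¹ ≤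
      (m : ℝ) ^ 2 / 2 / (1 + Real.log m) * (1 + Real.log m) :=
    mul_le_mul_of_nonneg_left h2 (by positivity)
  rw [div_mul_cancel₀ _ (by linarith)] at h3
  push_cast at h1
  nlinarith

/-- A set with `m` elements, where `m² ≥ 16 n (1 + log m)`, has a coset of a subgroup of order at
least `m / (2 (1 + log m))` among its subset sums. -/
theorem exists_coset_subset_subsetSums {G : Type*} [AddCommGroup G] [Fintype G]
    {A : Finset G} (hA : 2 ≤ A.card)
    (hcard : 16 * (Nat.card G : ℝ) * (1 + Real.log A.card) ≤ (A.card : ℝ) ^ 2) :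
    ∃ (K : AddSubgroup G) (v : G), (∀ k ∈ K, v + k ∈ subsetSums false (A : Set G)) ∧
      (A.card : ℝ) ≤ 2 * (1 + Real.log A.card) * Nat.card K := by
  classical
  have hA2 : (2 : ℝ) ≤ A.card := by exact_mod_cast hA
  have hlog : 0 ≤ Real.log A.card := Real.log_nonneg (by linarith)
  obtain ⟨t, ht1, htA, ht⟩ := exists_level_pairCount A hA
  obtain ⟨X, hX⟩ : ∃ X, X = Finset.univ.filter fun x => t ≤ pairCount A x := ⟨_, rfl⟩
  rw [← hX] at ht
  have hXne : X.Nonempty := by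
    rw [Finset.nonempty_iff_ne_empty]
    rintro rfl
    rw [Finset.card_empty, Nat.cast_zero, mul_zero, zero_mul] at ht
    nlinarith
  obtain ⟨x₀, hx₀⟩ := hXne
  obtain ⟨l, hl1, hl2⟩ : ∃ l, t ≤ 4 * l ∧ 4 * l < t + 4 := ⟨(t + 3) / 4, by omega, by omega⟩
  have hYc : (X.image (· - x₀)).card = X.card :=
    Finset.card_image_of_injective _ (sub_left_injective)
  have h0 : (0 : G) ∈ X.image (· - x₀) := Finset.mem_image.2 ⟨x₀, hx₀, sub_self _⟩
  have hlX : 2 * Fintype.card G ≤ l * (X.image (· - x₀)).card := by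
    rw [hYc]
    have h1 : (t : ℝ) ≤ 4 * l := by exact_mod_cast hl1
    have h2 : (t : ℝ) * X.card * (1 + Real.log A.card) ≤ 4 * l * X.card * (1 + Real.log A.card) :=
      by gcongr
    have h3 : (2 * Nat.card G : ℝ) * (1 + Real.log A.card) ≤
        l * X.card * (1 + Real.log A.card) := by linarith
    have h4 := le_of_mul_le_mul_right h3 (by linarith)
    rw [Nat.card_eq_fintype_card] at h4
    exact_mod_cast h4
  refine ⟨AddSubgroup.closure (X.image (· - x₀)), l • x₀, fun k hk => ?_, ?_⟩
  · obtain ⟨B, hBA, hBc, hBs⟩ := exists_sum_eq_of_le_pairCount (A := A)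
      (fun x hx => (by simpa [hX] using hx : t ≤ pairCount A x)) hl2 x₀
      (mem_iterate_add_of_mem_closure h0 hlX hk)
    exact ⟨B, Or.inr (Finset.card_pos.1 (by omega)), by exact_mod_cast hBA, hBs⟩
  · have hsub : (X.card : ℝ) ≤
        Nat.card (AddSubgroup.closure ((X.image (· - x₀) : Finset G) : Set G)) := by
      rw [← hYc, ← Set.ncard_coe_finset]
      exact Nat.cast_le.2 (Set.ncard_le_ncard AddSubgroup.subset_closure (Set.toFinite _))
    have h1 : (t : ℝ) ≤ A.card := by exact_mod_cast htA
    have h2 : (t : ℝ) * X.card * (1 + Real.log A.card) ≤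
        A.card * X.card * (1 + Real.log A.card) := by gcongr
    have h3 : (A.card : ℝ) * A.card ≤ A.card * (2 * (1 + Real.log A.card) * X.card) := by
      nlinarith
    refine (le_of_mul_le_mul_left h3 (by linarith)).trans ?_
    gcongr

/-- `|G / K|` elements outside of `K` have, modulo `K`, all elements of a strictly larger subgroup
among their subset sums. -/
theorem exists_lt_addSubgroup_of_index_le_card {G : Type*} [AddCommGroup G] [Fintype G]
    (K : AddSubgroup G) {R : Finset G} (hR : ∀ r ∈ R, r ∉ K) (hcard : K.index ≤ R.card) :
    ∃ B ⊆ R, B.card ≤ K.index ∧ ∃ K' : AddSubgroup G, K < K' ∧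
      ∀ k ∈ K', ∃ C ⊆ B, k - ∑ c ∈ C, c ∈ K := by
  classical
  let T : Finset G → Finset G := fun B => Finset.univ.filter fun x => ∃ C ⊆ B, x - ∑ c ∈ C, c ∈ K
  have hT : ∀ B x, x ∈ T B ↔ ∃ C ⊆ B, x - ∑ c ∈ C, c ∈ K := fun B x => by simp [T]
  have hTK : ∀ B, ∀ x ∈ T B, ∀ k ∈ K, k + x ∈ T B := by
    intro B x hx k hk
    obtain ⟨C, hC, h⟩ := (hT B x).1 hx
    exact (hT _ _).2 ⟨C, hC, by rw [add_sub_assoc]; exact K.add_mem hk h⟩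
  have hcoset : ∀ x : G, (Finset.univ.filter fun y => y - x ∈ K).card = Nat.card K := by
    intro x
    rw [Nat.card_eq_fintype_card, Fintype.card_subtype]
    exact Finset.card_bij (fun y _ => y - x) (by simp) (by simp)
      (fun k hk => ⟨k + x, by simpa using hk, by simp⟩)
  have hKpos : 0 < Nat.card K := Nat.card_pos
  obtain ⟨B, hB, hmax⟩ := Finset.exists_max_image
    (R.powerset.filter fun B => (B.card + 1) * Nat.card K ≤ (T B).card) Finset.card
    ⟨∅, by
      simp only [Finset.mem_filter, Finset.empty_mem_powerset, true_and, Finset.card_empty]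
      rw [zero_add, one_mul, ← hcoset 0]
      refine Finset.card_le_card fun y hy => (hT _ _).2 ⟨∅, le_rfl, ?_⟩
      simpa using hy⟩
  obtain ⟨hBR, hBT⟩ : B ⊆ R ∧ (B.card + 1) * Nat.card K ≤ (T B).card := by simpa using hB
  have hBc : B.card + 1 ≤ K.index := by
    refine Nat.le_of_mul_le_mul_right (hBT.trans ?_) hKpos
    rw [mul_comm, K.card_mul_index, Nat.card_eq_fintype_card]
    exact Finset.card_le_univ _
  obtain ⟨r, hrR, hrB⟩ := Finset.exists_mem_notMem_of_card_lt_card (show B.card < R.card by omega)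
  have h0T : (0 : G) ∈ T B := (hT _ _).2 ⟨∅, by simp, by simp⟩
  have hTr : ∀ x ∈ T B, r + x ∈ T B := by
    intro x hx
    by_contra hrx
    have hsub : T B ∪ (Finset.univ.filter fun y => y - (r + x) ∈ K) ⊆ T (insert r B) := by
      refine Finset.union_subset (fun y hy => ?_) fun y hy => ?_
      · obtain ⟨C, hC, h⟩ := (hT _ _).1 hy
        exact (hT _ _).2 ⟨C, hC.trans (Finset.subset_insert _ _), h⟩
      · obtain ⟨C, hC, h⟩ := (hT _ _).1 hx
        refine (hT _ _).2 ⟨insert r C, Finset.insert_subset_insert _ hC, ?_⟩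
        rw [Finset.sum_insert fun h => hrB (hC h)]
        have := K.add_mem (show y - (r + x) ∈ K by simpa using hy) h
        convert this using 1
        abel
    have hdisj : Disjoint (T B) (Finset.univ.filter fun y => y - (r + x) ∈ K) := by
      rw [Finset.disjoint_left]
      intro y hy hy'
      have := hTK B y hy _ (K.neg_mem (show y - (r + x) ∈ K by simpa using hy'))
      exact hrx (by convert this using 1; abel)
    have h1 := Finset.card_le_card hsub
    rw [Finset.card_union_of_disjoint hdisj, hcoset] at h1
    have h2 := hmax (insert r B) (by
      rw [Finset.mem_filter, Finset.mem_powerset]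
      refine ⟨Finset.insert_subset hrR hBR, ?_⟩
      rw [Finset.card_insert_of_notMem hrB, add_one_mul]
      omega)
    rw [Finset.card_insert_of_notMem hrB] at h2
    omega
  have hstab : ∀ g : G, (∀ x ∈ T B, g + x ∈ T B) → g ∈ AddAction.stabilizer G (T B) := by
    intro g hg
    rw [AddAction.mem_stabilizer_iff]
    refine Finset.eq_of_subset_of_card_le (fun y hy => ?_) (Finset.card_vadd_finset _ _).ge
    obtain ⟨x, hx, rfl⟩ := Finset.mem_vadd_finset.1 hy
    exact hg x hx
  refine ⟨B, hBR, by omega, AddAction.stabilizer G (T B), ?_, fun k hk => ?_⟩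
  · refine lt_of_le_of_ne (fun k hk => hstab k fun x hx => hTK B x hx k hk) fun h => ?_
    exact hR r hrR (h ▸ hstab r hTr)
  · have h : k +ᵥ (0 : G) ∈ k +ᵥ T B := Finset.vadd_mem_vadd_finset h0T
    rw [AddAction.mem_stabilizer_iff.1 hk, vadd_eq_add, add_zero] at h
    exact (hT _ _).1 h

theorem exists_coset_subset_subsetSums_of_subset {G : Type*} [AddCommGroup G] [Fintype G]
    [DecidableEq G] {A A₁ : Finset G} (hA : A₁ ⊆ A) (K : AddSubgroup G) (v : G)
    (hv : ∀ k ∈ K, v + k ∈ subsetSums false (A₁ : Set G)) :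
    ∃ K' : AddSubgroup G, (∀ k ∈ K', v + k ∈ subsetSums false (A : Set G)) ∧
      ((A : Set G) \ K').ncard ≤ A₁.card + 2 * K.index := by
  classical
  induction hN : K.index using Nat.strong_induction_on generalizing K A₁ with
  | _ N ih =>
    subst hN
    let R := (A \ A₁).filter fun x => x ∉ K
    have hR : ∀ r, r ∈ R ↔ (r ∈ A ∧ r ∉ A₁) ∧ r ∉ K := fun r => by simp [R]
    by_cases hc : K.index ≤ R.card
    · obtain ⟨B, hBR, hBc, K', hKK', hK'⟩ :=
        exists_lt_addSubgroup_of_index_le_card K (fun r hr => ((hR r).1 hr).2) hc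
      have hidx : 2 * K'.index ≤ K.index := by
        rw [← AddSubgroup.relIndex_mul_index hKK'.le]
        refine Nat.mul_le_mul_right _ ?_
        have h1 : K.relIndex K' ≠ 1 := fun h =>
          hKK'.not_ge (AddSubgroup.relIndex_eq_one.1 h)
        have h2 : K.relIndex K' ≠ 0 := AddSubgroup.FiniteIndex.index_ne_zero
        omega
      have hpos : 0 < K'.index := Nat.pos_of_ne_zero AddSubgroup.FiniteIndex.index_ne_zero
      obtain ⟨K'', h1, h2⟩ := ih K'.index (by omega) (A₁ := A₁ ∪ B)
        (Finset.union_subset hA fun b hb => ((hR b).1 (hBR hb)).1.1) K' (fun k hk => by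
          obtain ⟨C, hCB, hC⟩ := hK' k hk
          obtain ⟨B', hB'ne, hB'A, hB's⟩ := hv _ hC
          have hB'A : B' ⊆ A₁ := by exact_mod_cast hB'A
          have hdisj : Disjoint B' C := by
            rw [Finset.disjoint_left]
            exact fun x hx hx' => ((hR x).1 (hBR (hCB hx'))).1.2 (hB'A hx)
          refine ⟨B' ∪ C, Or.inr ?_, by exact_mod_cast Finset.union_subset_union hB'A hCB, ?_⟩
          · exact (hB'ne.resolve_left (by simp)).mono Finset.subset_union_left
          · rw [Finset.sum_union hdisj, hB's]
            abel) rfl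
      refine ⟨K'', h1, h2.trans ?_⟩
      have := Finset.card_union_le A₁ B
      omega
    · refine ⟨K, fun k hk => ?_, ?_⟩
      · obtain ⟨B, h1, h2, h3⟩ := hv k hk
        exact ⟨B, h1, h2.trans (by exact_mod_cast hA), h3⟩
      · have hsub : (A : Set G) \ K ⊆ ((A₁ ∪ R : Finset G) : Set G) := by
          rintro x ⟨hxA, hxK⟩
          rw [Finset.mem_coe, Finset.mem_union, hR]
          have hxA : x ∈ A := hxA
          by_cases hx : x ∈ A₁
          · exact Or.inl hx
          · exact Or.inr ⟨⟨hxA, hx⟩, hxK⟩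
        have h1 := Set.ncard_le_ncard hsub (Finset.finite_toSet _)
        rw [Set.ncard_coe_finset] at h1
        have := Finset.card_union_le A₁ R
        omega

/-- Up to a proportion `ε`, a set with at least `16 ε⁻¹ √(n (1 + log n))` elements lies in a
subgroup a coset of which consists of subset sums. -/
theorem exists_addSubgroup_ncard_diff_le {G : Type*} [AddCommGroup G] [Finite G] {ε : ℝ}
    (hε : 0 < ε) (hε1 : ε ≤ 1) (A : Set G)
    (hA : 256 / ε ^ 2 * (Nat.card G * (1 + Real.log (Nat.card G))) ≤ (A.ncard : ℝ) ^ 2) :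
    ∃ (K : AddSubgroup G) (v : G), (∀ k ∈ K, v + k ∈ subsetSums false A) ∧
      ((A \ K).ncard : ℝ) ≤ ε * A.ncard := by
  classical
  have := Fintype.ofFinite G
  obtain ⟨A, rfl⟩ : ∃ A' : Finset G, (A' : Set G) = A := ⟨A.toFinset, by simp⟩
  rw [Set.ncard_coe_finset] at *
  set n : ℝ := (Nat.card G : ℝ) with hn
  have hn1 : 1 ≤ n := by rw [hn]; exact_mod_cast Nat.card_pos (α := G)
  have hL : 0 ≤ Real.log n := Real.log_nonneg hn1
  set a : ℝ := (A.card : ℝ) with ha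
  have ha0 : 0 ≤ a := Nat.cast_nonneg _
  have hA' : 256 * (n * (1 + Real.log n)) ≤ (ε * a) ^ 2 := by
    rw [div_mul_eq_mul_div, div_le_iff₀ (by positivity)] at hA
    linarith
  have hnL : 1 ≤ n * (1 + Real.log n) := by nlinarith
  have hεa : 16 ≤ ε * a := by
    refine le_of_sq_le_sq ?_ (by positivity)
    linarith
  set m := ⌊ε * a / 2⌋₊ with hm
  have hm1 : (m : ℝ) ≤ ε * a / 2 := Nat.floor_le (by positivity)
  have hm2 : ε * a / 4 ≤ m := by
    have := Nat.lt_floor_add_one (ε * a / 2)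
    linarith
  have hmA : m ≤ A.card := by
    have : (m : ℝ) ≤ a := by nlinarith
    exact Nat.cast_le.1 this
  obtain ⟨A₁, hA₁, hA₁c⟩ := Finset.exists_subset_card_eq hmA
  have hm4 : (4 : ℝ) ≤ m := by linarith
  have hmn : (m : ℝ) ≤ n := by
    rw [hn, Nat.card_eq_fintype_card, ← hA₁c]
    exact_mod_cast Finset.card_le_univ A₁
  have hlog : Real.log m ≤ Real.log n := Real.log_le_log (by linarith) hmn
  have hlog0 : 0 ≤ Real.log m := Real.log_nonneg (by linarith)
  obtain ⟨K, v, hv, hK⟩ := exists_coset_subset_subsetSums (A := A₁)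
    (by rw [hA₁c]; exact_mod_cast (by linarith : (2 : ℝ) ≤ m)) (by
      rw [hA₁c]
      calc 16 * n * (1 + Real.log m) ≤ 16 * n * (1 + Real.log n) := by gcongr
        _ ≤ (ε * a / 4) ^ 2 := by linarith
        _ ≤ (m : ℝ) ^ 2 := by gcongr)
  rw [hA₁c] at hK
  obtain ⟨K', hK', hd⟩ := exists_coset_subset_subsetSums_of_subset hA₁ K v hv
  refine ⟨K', v, hK', ?_⟩
  have hidx : (Nat.card K : ℝ) * K.index = n := by rw [hn]; exact_mod_cast K.card_mul_index
  have hidx0 : (0 : ℝ) ≤ K.index := Nat.cast_nonneg _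
  have h1 : ε * a / 4 * K.index ≤ 2 * (n * (1 + Real.log n)) := by
    calc ε * a / 4 * K.index ≤ 2 * (1 + Real.log m) * Nat.card K * K.index :=
          mul_le_mul_of_nonneg_right (hm2.trans hK) hidx0
      _ = 2 * (n * (1 + Real.log m)) := by rw [← hidx]; ring
      _ ≤ 2 * (n * (1 + Real.log n)) := by gcongr
  have h2 : (ε * a) * (K.index : ℝ) ≤ (ε * a) * (ε * a / 32) := by nlinarith
  have h3 := le_of_mul_le_mul_left h2 (by linarith)
  have h4 : (((A : Set G) \ K').ncard : ℝ) ≤ m + 2 * K.index := by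
    rw [← hA₁c]
    exact_mod_cast hd
  linarith

theorem exists_addSubgroup_le_ncard_diff_le {G : Type*} [AddCommGroup G] [Finite G] {ε : ℝ}
    (hε : 0 < ε) (hε1 : ε ≤ 1) (H : AddSubgroup G) {A : Set G} (hAH : A ⊆ H)
    (hA : 256 / ε ^ 2 * (Nat.card G * (1 + Real.log (Nat.card G))) ≤ (A.ncard : ℝ) ^ 2) :
    ∃ K ≤ H, ∃ v : G, (∀ k ∈ K, v + k ∈ subsetSums false A) ∧
      ((A \ K).ncard : ℝ) ≤ ε * A.ncard := by
  have hcoe : ((↑) : H → G) '' ((↑) ⁻¹' A) = A :=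
    Subtype.image_preimage_coe _ _ |>.trans (Set.inter_eq_right.2 hAH)
  have hinj : Function.Injective ((↑) : H → G) := Subtype.val_injective
  have hc : ((↑) ⁻¹' A : Set H).ncard = A.ncard := by
    rw [← Set.ncard_image_of_injective _ hinj, hcoe]
  have hHG : (Nat.card H : ℝ) ≤ Nat.card G := by exact_mod_cast Nat.card_le_card_of_injective _ hinj
  have hH1 : (1 : ℝ) ≤ Nat.card H := by exact_mod_cast Nat.card_pos (α := H)
  obtain ⟨K, v, hv, hK⟩ := exists_addSubgroup_ncard_diff_le hε hε1 ((↑) ⁻¹' A : Set H) (by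
    rw [hc]
    refine le_trans ?_ hA
    have := Real.log_nonneg hH1
    gcongr)
  refine ⟨K.map H.subtype, ?_, v, ?_, ?_⟩
  · rintro _ ⟨k, -, rfl⟩
    exact k.2
  · rintro _ ⟨k, hk, rfl⟩
    obtain ⟨B, hB, hBA, hBs⟩ := hv k hk
    refine ⟨B.map ⟨_, hinj⟩, ?_, ?_, ?_⟩
    · simpa using hB
    · rw [Finset.coe_map]
      exact (Set.image_mono hBA).trans hcoe.subset
    · rw [Finset.sum_map]
      have := congrArg H.subtype hBs
      rw [map_sum] at this
      simpa using this
  · rw [hc] at hK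
    refine le_trans ?_ hK
    rw [← Set.ncard_image_of_injective _ hinj, Set.image_sdiff hinj, hcoe]
    exact le_of_eq rfl

theorem prime_of_dvd_prod_of_lt {t : ℕ} (h0 : 0 < t) (h1 : 1 < t) {p : Fin t → ℕ}
    (hp : ∀ i, (p i).Prime) (hmono : Monotone p) {d : ℕ} (hd : d ∣ ∏ i, p i)
    (hlt : d < p ⟨0, h0⟩ * p ⟨1, h1⟩) (hd1 : d ≠ 1) : d.Prime := by
  have hd0 : d ≠ 0 := by
    rintro rfl
    exact (Finset.prod_ne_zero_iff.2 fun i _ => (hp i).ne_zero) (Nat.eq_zero_of_zero_dvd hd)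
  have hr := Nat.minFac_prime hd1
  obtain ⟨e, he⟩ := Nat.minFac_dvd d
  by_cases he1 : e = 1
  · rw [he1, mul_one] at he
    rw [he]
    exact hr
  exfalso
  have hs := Nat.minFac_prime he1
  generalize d.minFac = r at *
  have hsd := Nat.minFac_dvd e
  generalize e.minFac = s at *
  have hrs : r * s ∣ d := he ▸ Nat.mul_dvd_mul_left r hsd
  obtain ⟨i, -, hi⟩ := (hr.prime.dvd_finsetProd_iff _).1 ((dvd_of_mul_right_dvd hrs).trans hd)
  rw [Nat.prime_dvd_prime_iff_eq hr (hp i)] at hi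
  have h2 : s ∣ ∏ j ∈ Finset.univ.erase i, p j := by
    have := hrs.trans hd
    rw [← Finset.mul_prod_erase _ _ (Finset.mem_univ i), ← hi] at this
    exact Nat.dvd_of_mul_dvd_mul_left hr.pos this
  obtain ⟨j, hj, hj'⟩ := (hs.prime.dvd_finsetProd_iff _).1 h2
  rw [Nat.prime_dvd_prime_iff_eq hs (hp j)] at hj'
  have hij : j ≠ i := Finset.ne_of_mem_erase hj
  have hle : ∀ i j : Fin t, i < j → p ⟨0, h0⟩ * p ⟨1, h1⟩ ≤ p i * p j := by
    intro i j hij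
    refine Nat.mul_le_mul (hmono ?_) (hmono ?_)
    · exact Fin.mk_le_of_le_val (Nat.zero_le _)
    · exact Fin.mk_le_of_le_val (Nat.one_le_iff_ne_zero.2 (by have := Fin.lt_def.1 hij; omega))
  have h3 := Nat.le_of_dvd (Nat.pos_of_ne_zero hd0) hrs
  rw [hi, hj'] at h3
  rcases lt_or_gt_of_ne hij with h | h
  · have := hle j i h
    rw [mul_comm (p j)] at this
    omega
  · have := hle i j h
    omega

theorem subsetSums_mono {G : Type*} [AddCommGroup G] (b : Bool) {A A' : Set G} (h : A ⊆ A') :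
    subsetSums b A ⊆ subsetSums b A' := by
  rintro x ⟨B, h1, h2, h3⟩
  exact ⟨B, h1, h2.trans h, h3⟩

theorem subsetSums_false_subset {G : Type*} [AddCommGroup G] (b : Bool) (A : Set G) :
    subsetSums false A ⊆ subsetSums b A := by
  rintro x ⟨B, h1, h2, h3⟩
  exact ⟨B, Or.inr (h1.resolve_left (by simp)), h2, h3⟩

theorem subsetSums_subset_addSubgroup {G : Type*} [AddCommGroup G] (b : Bool) {A : Set G}
    {H : AddSubgroup G} (h : A ⊆ H) : subsetSums b A ⊆ H := by
  rintro x ⟨B, -, h2, rfl⟩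
  exact H.sum_mem fun y hy => h (h2 hy)

theorem subsetSums_eq_of_coset {G : Type*} [AddCommGroup G] (b : Bool) {A : Set G}
    {H : AddSubgroup G} (h : A ⊆ H) {v : G} (hv : ∀ k ∈ H, v + k ∈ subsetSums false A) :
    subsetSums b A = H := by
  refine (subsetSums_subset_addSubgroup b h).antisymm fun x hx => subsetSums_false_subset b A ?_
  have hvH : v ∈ H := by
    have := subsetSums_subset_addSubgroup false h (hv 0 H.zero_mem)
    simpa using this
  simpa using hv (x - v) (H.sub_mem hx hvH)

/-- An incomplete set is nice if it is large compared with `√(n log n)` and, up to a proportion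
`2 ε`, with `n / m`, where every index below `m` of a subgroup is `1` or a prime. -/
theorem isNice_of_isIncomplete {G : Type*} [AddCommGroup G] [Finite G] (b : Bool) {ε : ℝ}
    (hε : 0 < ε) (hε1 : ε ≤ 1 / 2) {m : ℝ} (hm : 0 < m)
    (hidx : ∀ K : AddSubgroup G, (K.index : ℝ) < m → K.index ≠ 1 → K.index.Prime)
    {A : Set G} (hinc : IsIncomplete b A)
    (hA : 256 / ε ^ 2 * (Nat.card G * (1 + Real.log (Nat.card G))) ≤ ((1 - ε) * A.ncard) ^ 2)
    (hAm : (Nat.card G : ℝ) / m < (1 - ε) * ((1 - ε) * A.ncard)) : IsNice b A := by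
  have hm' : ∀ K : AddSubgroup G, (Nat.card G : ℝ) / m < Nat.card K → (K.index : ℝ) < m := by
    intro K hK
    rw [div_lt_iff₀ hm, ← K.card_mul_index, Nat.cast_mul] at hK
    exact lt_of_mul_lt_mul_left hK (Nat.cast_nonneg _)
  have hsplit : ∀ (A : Set G) (K : AddSubgroup G), ((A \ K).ncard : ℝ) ≤ ε * A.ncard →
      (1 - ε) * A.ncard ≤ (A ∩ K).ncard := by
    intro A K h
    have := Set.ncard_inter_add_ncard_sdiff_eq_ncard A K (Set.toFinite _)
    have : ((A ∩ K).ncard : ℝ) + (A \ K).ncard = A.ncard := by exact_mod_cast this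
    linarith
  have hcardK : ∀ (A : Set G) (K : AddSubgroup G), ((A ∩ K).ncard : ℝ) ≤ Nat.card K := by
    intro A K
    exact Nat.cast_le.2 (Set.ncard_le_ncard Set.inter_subset_right (Set.toFinite _))
  have ha : (0 : ℝ) ≤ A.ncard := Nat.cast_nonneg _
  obtain ⟨K, -, v, hv, hK⟩ := exists_addSubgroup_le_ncard_diff_le hε (by linarith) ⊤
    (A := A) (Set.subset_univ _) (hA.trans (by
      have : (1 - ε) * A.ncard ≤ A.ncard := by nlinarith
      have : 0 ≤ (1 - ε) * (A.ncard : ℝ) := mul_nonneg (by linarith) ha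
      gcongr))
  have hKA := hsplit A K hK
  have hpos : 0 ≤ (1 - ε) * (A.ncard : ℝ) := mul_nonneg (by linarith) ha
  have hK1 : K.index ≠ 1 := by
    intro h
    rw [AddSubgroup.index_eq_one] at h
    subst h
    refine hinc ?_
    rw [subsetSums_eq_of_coset b (Set.subset_univ _) hv, AddSubgroup.coe_top]
  have hKp := hidx K (hm' K (by
    have := hcardK A K
    nlinarith)) hK1
  obtain ⟨K', hK'K, v', hv', hK'⟩ := exists_addSubgroup_le_ncard_diff_le hε (by linarith) K
    (A := A ∩ K) Set.inter_subset_right (hA.trans (by gcongr))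
  have hK'1 : K'.index ≠ 1 := by
    intro h
    rw [AddSubgroup.index_eq_one] at h
    subst h
    exact hK1 (AddSubgroup.index_eq_one.2 (top_le_iff.1 hK'K))
  have hK'p := hidx K' (hm' K' (by
    have h1 := hcardK (A ∩ K) K'
    have h2 := hsplit _ K' hK'
    have h3 : (1 - ε) * ((1 - ε) * A.ncard) ≤ (1 - ε) * (A ∩ K).ncard :=
      mul_le_mul_of_nonneg_left hKA (by linarith)
    linarith)) hK'1
  have heq : K' = K := by
    refine le_antisymm hK'K (AddSubgroup.relIndex_eq_one.1 ?_)
    rw [← AddSubgroup.relIndex_mul_index hK'K] at hK'p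
    exact (Nat.prime_mul_iff.1 hK'p).elim (fun h => absurd h.2 hK1) fun h => h.2
  subst heq
  exact ⟨K', hKp, subsetSums_eq_of_coset b Set.inter_subset_right hv'⟩

/-- The axis `0 × ℤ/q` together with the points `(1, 0), …, (p - 1, 0)`. -/
def axisWithInterval (p q : ℕ) : Set (ZMod (p ^ 2) × ZMod q) :=
  Set.range (fun z : ZMod q => (0, z)) ∪ (fun i : ℕ => ((i : ZMod (p ^ 2)), 0)) '' Set.Icc 1 (p - 1)

theorem natCast_injOn_Icc {p : ℕ} (hp : 1 < p) :
    Set.InjOn (fun i : ℕ => (i : ZMod (p ^ 2))) (Set.Icc 0 (p - 1)) := by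
  intro i hi j hj h
  have hlt : ∀ i ∈ Set.Icc 0 (p - 1), i < p ^ 2 := fun i hi => by
    have := hi.2
    nlinarith [Nat.sub_add_cancel hp.le]
  exact ((ZMod.natCast_eq_natCast_iff _ _ _).1 h).eq_of_lt_of_lt (hlt i hi) (hlt j hj)

theorem ncard_axisWithInterval {p q : ℕ} (hp : 1 < p) [NeZero q] :
    (axisWithInterval p q).ncard = q + (p - 1) := by
  have : NeZero (p ^ 2) := ⟨by positivity⟩
  rw [axisWithInterval, Set.ncard_union_eq, ← Set.image_univ, Set.ncard_image_of_injective,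
    Set.InjOn.ncard_image, Set.ncard_univ, Nat.card_zmod, Set.ncard_eq_toFinset_card']
  · simp
  · intro i hi j hj h
    exact natCast_injOn_Icc hp ⟨Nat.zero_le _, hi.2⟩ ⟨Nat.zero_le _, hj.2⟩ (Prod.ext_iff.1 h).1
  · exact fun x y h => (Prod.ext_iff.1 h).2
  · rw [Set.disjoint_left]
    rintro _ ⟨z, rfl⟩ ⟨i, hi, h⟩
    have : i = 0 := natCast_injOn_Icc hp ⟨Nat.zero_le _, hi.2⟩ ⟨le_rfl, Nat.zero_le _⟩
      (by simpa using (Prod.ext_iff.1 h).1)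
    have := hi.1
    omega

theorem fst_ne_neg_one_of_mem_subsetSums {p q : ℕ} (hp : 1 < p) [NeZero q] {b : Bool}
    {x : ZMod (p ^ 2) × ZMod q} (hx : x ∈ subsetSums b (axisWithInterval p q)) : x.1 ≠ -1 := by
  classical
  have : NeZero (p ^ 2) := ⟨by positivity⟩
  obtain ⟨B, -, hB, rfl⟩ := hx
  have hval : ∀ i ≤ p - 1, (i : ZMod (p ^ 2)).val = i := fun i hi =>
    ZMod.val_cast_of_lt (by nlinarith [Nat.sub_add_cancel hp.le])
  have hsum : ∑ c ∈ B, c.1.val ≤ (p - 1) * (p - 1) := by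
    have h1 : ∑ c ∈ B, c.1.val ≤ ∑ c ∈ (Finset.Icc 1 (p - 1)).image
        (fun i : ℕ => ((i : ZMod (p ^ 2)), (0 : ZMod q))), c.1.val := by
      refine Finset.sum_le_sum_of_ne_zero fun c hc h => ?_
      rcases hB hc with ⟨z, rfl⟩ | ⟨i, hi, rfl⟩
      · simp at h
      · exact Finset.mem_image_of_mem _ (Finset.mem_Icc.2 hi)
    refine h1.trans ((Finset.sum_le_card_nsmul _ _ (p - 1) ?_).trans ?_)
    · intro c hc
      obtain ⟨i, hi, rfl⟩ := Finset.mem_image.1 hc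
      exact (hval i (Finset.mem_Icc.1 hi).2).trans_le (Finset.mem_Icc.1 hi).2
    · rw [smul_eq_mul]
      refine Nat.mul_le_mul_right _ (Finset.card_image_le.trans ?_)
      simp
  intro h
  have h0 : ((∑ c ∈ B, c.1.val + 1 : ℕ) : ZMod (p ^ 2)) = 0 := by
    rw [Prod.fst_sum] at h
    push_cast
    simp only [ZMod.natCast_val, ZMod.cast_id', id]
    rw [h, neg_add_cancel]
  have h1 := Nat.le_of_dvd (Nat.succ_pos _) ((ZMod.natCast_eq_zero_iff _ _).1 h0)
  obtain ⟨r, rfl⟩ : ∃ r, p = r + 2 := ⟨p - 2, by omega⟩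
  have h2 : r + 2 - 1 = r + 1 := rfl
  rw [h2] at hsum
  nlinarith

theorem isIncomplete_axisWithInterval {p q : ℕ} (hp : 1 < p) [NeZero q] (b : Bool) :
    IsIncomplete b (axisWithInterval p q) := fun h =>
  fst_ne_neg_one_of_mem_subsetSums hp (x := (-1, 0)) (h ▸ Set.mem_univ _) rfl

theorem not_isNice_axisWithInterval {p q : ℕ} (hp : p.Prime) [NeZero q] (b : Bool) :
    ¬ IsNice b (axisWithInterval p q) := by
  rintro ⟨H, hH, hS⟩
  have hne : ∀ x ∈ H, x.1 ≠ -1 := fun x hx => by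
    have hx : x ∈ (H : Set (ZMod (p ^ 2) × ZMod q)) := hx
    rw [← hS] at hx
    exact fst_ne_neg_one_of_mem_subsetSums hp.one_lt (subsetSums_mono b Set.inter_subset_left hx)
  have hsub : axisWithInterval p q ∩ H ⊆
      (AddSubgroup.prod (⊥ : AddSubgroup (ZMod (p ^ 2))) (⊤ : AddSubgroup (ZMod q)) :
        Set (ZMod (p ^ 2) × ZMod q)) := by
    rintro _ ⟨⟨z, rfl⟩ | ⟨i, hi, rfl⟩, hxH⟩
    · exact ⟨rfl, trivial⟩
    · exfalso
      have hcop : i.Coprime (p ^ 2) := by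
        refine Nat.Coprime.pow_right 2 (Nat.Coprime.symm ((hp.coprime_iff_not_dvd).2 fun h => ?_))
        have := Nat.le_of_dvd hi.1 h
        have := hi.2
        have := hp.pos
        omega
      obtain ⟨u, hu⟩ : IsUnit (i : ZMod (p ^ 2)) := (ZMod.isUnit_iff_coprime _ _).2 hcop
      have : NeZero (p ^ 2) := ⟨pow_ne_zero _ hp.ne_zero⟩
      refine hne _ (H.nsmul_mem hxH (-(↑u⁻¹ : ZMod (p ^ 2))).val) ?_
      simp [← hu]
  have hHle : H ≤ AddSubgroup.prod (⊥ : AddSubgroup (ZMod (p ^ 2))) ⊤ := fun x hx =>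
    subsetSums_subset_addSubgroup b hsub (hS.symm ▸ hx)
  have hcard : Nat.card H ∣ q := by
    have := AddSubgroup.card_dvd_of_le hHle
    rwa [Nat.card_congr (AddSubgroup.prodEquiv _ _).toEquiv, Nat.card_prod, AddSubgroup.card_bot,
      one_mul, AddSubgroup.card_top, Nat.card_zmod] at this
  obtain ⟨c, hc⟩ := hcard
  have hidx := H.card_mul_index
  rw [Nat.card_prod, Nat.card_zmod, Nat.card_zmod] at hidx
  have hpos : 0 < Nat.card H := Nat.pos_of_ne_zero fun h => NeZero.ne q (by rw [hc, h, zero_mul])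
  have h2 : H.index = p ^ 2 * c := Nat.eq_of_mul_eq_mul_left hpos (by
    rw [hidx]
    nth_rewrite 1 [hc]
    ring)
  have hH : H.index.Prime := hH
  rw [h2] at hH
  have h3 : p = 1 := by
    by_contra h
    have h4 := (Nat.prime_dvd_prime_iff_eq hp hH).1 ⟨p * c, by ring⟩
    have : p ^ 2 ∣ p := by nth_rewrite 2 [h4]; exact ⟨c, rfl⟩
    have := Nat.le_of_dvd hp.pos this
    nlinarith [hp.two_le]
  exact hp.one_lt.ne' h3

open Filter Asymptotics in
theorem exists_primes_of_pos {α D : ℝ} (hα : 0 < α) (hD : 0 < D) : ∃ p q : ℕ,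
    p.Prime ∧ q.Prime ∧ p < q ∧
    (p : ℝ) ^ 2 * D ^ 2 * Real.log ((p ^ 2 * q : ℕ) : ℝ) ≤ q ∧
    (((p ^ 2 * q : ℕ) : ℝ)) ^ (1 / 4 - α) ≤ p - 1 := by
  set β : ℝ := 4 * α with hβ
  set γ : ℝ := max (1 / 4 - α) 0 with hγ
  have hγ0 : 0 ≤ γ := le_max_right _ _
  have hγ1 : (4 + β) * γ < 1 := by
    rcases max_cases (1 / 4 - α) 0 with ⟨h, -⟩ | ⟨h, -⟩
    · rw [hγ, h, hβ]; nlinarith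
    · rw [hγ, h]; norm_num
  have e1 : ∀ᶠ P : ℝ in atTop, D ^ 2 * (Real.log 4 + (4 + β) * Real.log P) ≤ P ^ β := by
    have h1 : (fun P : ℝ => D ^ 2 * (Real.log 4 + (4 + β) * Real.log P)) =o[atTop]
        fun P : ℝ => P ^ β := by
      refine IsLittleO.const_mul_left (IsLittleO.add ?_ ?_) _
      · exact isLittleO_const_left.2 (Or.inr (tendsto_norm_atTop_atTop.comp
          (tendsto_rpow_atTop (by positivity))))
      · exact (isLittleO_log_rpow_atTop (by positivity)).const_mul_left _
    filter_upwards [h1.bound one_pos, eventually_ge_atTop 0] with P hP hP0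
    rw [one_mul, Real.norm_of_nonneg (Real.rpow_nonneg hP0 β)] at hP
    exact (le_abs_self _).trans hP
  have e2 : ∀ᶠ P : ℝ in atTop, (4 * P ^ (4 + β)) ^ γ ≤ P - 1 := by
    have h1 : (fun P : ℝ => 4 ^ γ * P ^ ((4 + β) * γ)) =o[atTop] fun P : ℝ => P := by
      refine IsLittleO.const_mul_left (isLittleO_of_tendsto' ?_ ?_) _
      · filter_upwards [eventually_gt_atTop 0] with P hP h
        exact absurd h hP.ne'
      · refine (tendsto_rpow_neg_atTop (sub_pos.2 hγ1)).congr' ?_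
        filter_upwards [eventually_gt_atTop 0] with P hP
        rw [neg_sub, Real.rpow_sub hP, Real.rpow_one]
    filter_upwards [h1.bound (c := 1 / 2) (by norm_num), eventually_ge_atTop 2] with P hP hP0
    rw [Real.norm_of_nonneg (show 0 ≤ P by linarith)] at hP
    rw [Real.mul_rpow (by norm_num) (by positivity), ← Real.rpow_mul (by linarith)]
    have := (le_abs_self _).trans hP
    linarith
  obtain ⟨N, hN⟩ := (tendsto_natCast_atTop_atTop.eventually (e1.and e2)).exists_forall_of_atTop
  obtain ⟨p, hpN, hp⟩ := Nat.exists_infinite_primes N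
  obtain ⟨h1, h2⟩ := hN p hpN
  have hp1 : (1 : ℝ) ≤ p := by exact_mod_cast hp.one_lt.le
  have hpβ : 1 ≤ (p : ℝ) ^ β := Real.one_le_rpow hp1 (by positivity)
  set k := ⌈(p : ℝ) ^ β⌉₊ with hk
  have hk1 : (p : ℝ) ^ β ≤ k := Nat.le_ceil _
  have hk2 : (k : ℝ) ≤ 2 * (p : ℝ) ^ β := by
    have := Nat.ceil_lt_add_one (zero_le_one.trans hpβ)
    linarith
  have hk0 : 0 < k := Nat.ceil_pos.2 (by linarith)
  obtain ⟨q, hq, hq1, hq2⟩ := Nat.exists_prime_lt_and_le_two_mul (p ^ 2 * k)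
    (mul_ne_zero (pow_ne_zero _ hp.ne_zero) hk0.ne')
  have hq1' : (p : ℝ) ^ 2 * k < q := by exact_mod_cast hq1
  have hq2' : (q : ℝ) ≤ 2 * ((p : ℝ) ^ 2 * k) := by exact_mod_cast hq2
  have hpq : p < q := by nlinarith [hp.one_lt]
  have hn : ((p ^ 2 * q : ℕ) : ℝ) ≤ 4 * (p : ℝ) ^ (4 + β) := by
    have h4 : (p : ℝ) ^ (4 + β) = p ^ 4 * (p : ℝ) ^ β := by
      rw [Real.rpow_add (by linarith)]
      norm_cast
    rw [h4]
    push_cast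
    calc (p : ℝ) ^ 2 * q ≤ p ^ 2 * (2 * (p ^ 2 * (2 * (p : ℝ) ^ β))) := by
          gcongr
          exact hq2'.trans (by gcongr)
      _ = 4 * (p ^ 4 * (p : ℝ) ^ β) := by ring
  have hn1 : (1 : ℝ) ≤ ((p ^ 2 * q : ℕ) : ℝ) := by
    exact_mod_cast Nat.mul_pos (pow_pos hp.pos 2) hq.pos
  refine ⟨p, q, hp, hq, hpq, ?_, ?_⟩
  · have hlog : Real.log ((p ^ 2 * q : ℕ) : ℝ) ≤ Real.log 4 + (4 + β) * Real.log p := by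
      refine (Real.log_le_log (by linarith) hn).trans_eq ?_
      rw [Real.log_mul (by norm_num) (by positivity), Real.log_rpow (by linarith)]
    calc (p : ℝ) ^ 2 * D ^ 2 * Real.log ((p ^ 2 * q : ℕ) : ℝ)
        ≤ (p : ℝ) ^ 2 * D ^ 2 * (Real.log 4 + (4 + β) * Real.log p) := by gcongr
      _ = (p : ℝ) ^ 2 * (D ^ 2 * (Real.log 4 + (4 + β) * Real.log p)) := by ring
      _ ≤ (p : ℝ) ^ 2 * k := by gcongr; exact h1.trans hk1
      _ ≤ q := hq1'.le
  · calc ((p ^ 2 * q : ℕ) : ℝ) ^ (1 / 4 - α) ≤ ((p ^ 2 * q : ℕ) : ℝ) ^ γ :=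
          Real.rpow_le_rpow_of_exponent_le hn1 (le_max_left _ _)
      _ ≤ (4 * (p : ℝ) ^ (4 + β)) ^ γ := Real.rpow_le_rpow (by linarith) hn hγ0
      _ ≤ p - 1 := h2

theorem theorem2p6 (allowEmpty : Bool) :
    (∀ δ : ℝ, 0 < δ → ∃ D : ℝ, 0 < D ∧
      ∀ (t : ℕ) (ht : 3 ≤ t) (p : Fin t → ℕ), (∀ i, (p i).Prime) → Monotone p →
      ∀ (p₁ p₂ n : ℕ), p₁ = p ⟨0, by omega⟩ → p₂ = p ⟨1, by omega⟩ → n = ∏ i, p i →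
        (p₁ : ℝ) * p₂ ≤ 1 / D * √((n : ℝ) / Real.log n) →
      ∀ (G : Type u) [AddCommGroup G], Nat.card G = n →
      ∀ A : Set G, IsIncomplete allowEmpty A →
        (1 + δ) * ((n : ℝ) / ((p₁ : ℝ) * p₂)) ≤ (A.ncard : ℝ) →
        IsNice allowEmpty A) ∧
    -- for `n = p₁ p₂ p₃` with `p₁ = p₂ = p < q = p₃`, in the group `ℤ/p² ⊕ ℤ/q`
    (∀ α : ℝ, 0 < α → ∀ D : ℝ, 0 < D →
      ∃ p q n : ℕ, p.Prime ∧ q.Prime ∧ p < q ∧ n = p ^ 2 * q ∧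
        (p : ℝ) * p ≤ 1 / D * √((n : ℝ) / Real.log n) ∧
        ∃ A : Set (ZMod (p ^ 2) × ZMod q), IsIncomplete allowEmpty A ∧
          (n : ℝ) / ((p : ℝ) * p) + (n : ℝ) ^ (1 / 4 - α) ≤ (A.ncard : ℝ) ∧
          ¬ IsNice allowEmpty A) := by
  constructor
  · intro δ hδ
    obtain ⟨ε, hε⟩ : ∃ ε, ε = δ / (2 * (1 + δ)) := ⟨_, rfl⟩
    have hε' : ε * (2 * (1 + δ)) = δ := by rw [hε]; field_simp
    have hε0 : 0 < ε := by rw [hε]; positivity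
    have hε1 : ε ≤ 1 / 2 := by nlinarith
    refine ⟨64 / ε, by positivity, ?_⟩
    intro t ht p hp hmono p₁ p₂ n hp₁ hp₂ hn hbound G _ hG A hinc hA
    have hp1 : 2 ≤ p₁ := hp₁ ▸ (hp _).two_le
    have hp2 : 2 ≤ p₂ := hp₂ ▸ (hp _).two_le
    have hm : (0 : ℝ) < (p₁ : ℝ) * p₂ := by positivity
    have hn8 : 8 ≤ n := by
      calc 8 = 2 ^ 3 := rfl
        _ ≤ 2 ^ t := Nat.pow_le_pow_right (by norm_num) ht
        _ = ∏ _i : Fin t, 2 := by simp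
        _ ≤ n := hn ▸ Finset.prod_le_prod' fun i _ => (hp i).two_le
    have : Finite G := Nat.finite_of_card_ne_zero (by omega)
    have hn8' : (8 : ℝ) ≤ n := by exact_mod_cast hn8
    have hlog : 1 ≤ Real.log n := by
      rw [Real.le_log_iff_exp_le (by linarith)]
      linarith [Real.exp_one_lt_d9]
    have hnm : (0 : ℝ) < n / ((p₁ : ℝ) * p₂) := by positivity
    have ha : (n : ℝ) / ((p₁ : ℝ) * p₂) ≤ A.ncard := by nlinarith
    have hbig : (64 / ε) ^ 2 * (n * Real.log n) ≤ (A.ncard : ℝ) ^ 2 := by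
      have h1 : (64 / ε * ((p₁ : ℝ) * p₂)) ^ 2 ≤ n / Real.log n := by
        rw [← Real.le_sqrt (by positivity) (by positivity)]
        rw [one_div_mul_eq_div, le_div_iff₀ (by positivity)] at hbound
        linarith
      rw [le_div_iff₀ (by linarith)] at h1
      have h2 : (64 / ε) ^ 2 * (n * Real.log n) ≤ (n / ((p₁ : ℝ) * p₂)) ^ 2 := by
        rw [div_pow (n : ℝ), le_div_iff₀ (by positivity)]
        nlinarith
      exact h2.trans (by gcongr)
    refine isNice_of_isIncomplete allowEmpty hε0 hε1 hm (fun K hK hK1 => ?_) hinc ?_ ?_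
    · refine prime_of_dvd_prod_of_lt (by omega) (by omega) hp hmono ?_ ?_ hK1
      · rw [← hn, ← hG]
        exact K.index_dvd_card
      · rw [← hp₁, ← hp₂]
        exact_mod_cast hK
    · rw [hG]
      calc 256 / ε ^ 2 * (n * (1 + Real.log n)) ≤ 256 / ε ^ 2 * (n * (2 * Real.log n)) := by
            gcongr
            linarith
        _ ≤ (1 / 2) ^ 2 * ((64 / ε) ^ 2 * (n * Real.log n)) := by
            have h : 0 ≤ n * Real.log n / ε ^ 2 := by positivity
            calc 256 / ε ^ 2 * (n * (2 * Real.log n)) = 512 * (n * Real.log n / ε ^ 2) := by ring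
              _ ≤ 1024 * (n * Real.log n / ε ^ 2) := by linarith
              _ = (1 / 2) ^ 2 * ((64 / ε) ^ 2 * (n * Real.log n)) := by ring
        _ ≤ (1 / 2) ^ 2 * (A.ncard : ℝ) ^ 2 := by gcongr
        _ = (1 / 2 * (A.ncard : ℝ)) ^ 2 := by ring
        _ ≤ ((1 - ε) * A.ncard) ^ 2 := by
            gcongr
            linarith
    · rw [hG]
      calc (n : ℝ) / ((p₁ : ℝ) * p₂) < (1 - ε) * (1 - ε) * (1 + δ) * (n / ((p₁ : ℝ) * p₂)) := by
            have h : 1 < (1 - ε) * (1 - ε) * (1 + δ) := by nlinarith [mul_pos hε0 hε0]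
            nlinarith
        _ = (1 - ε) * (1 - ε) * ((1 + δ) * (n / ((p₁ : ℝ) * p₂))) := by ring
        _ ≤ (1 - ε) * (1 - ε) * A.ncard :=
            mul_le_mul_of_nonneg_left hA (mul_self_nonneg _)
        _ = (1 - ε) * ((1 - ε) * A.ncard) := by ring
  · intro α hα D hD
    obtain ⟨p, q, hp, hq, hpq, h1, h2⟩ := exists_primes_of_pos hα hD
    have : NeZero q := ⟨hq.ne_zero⟩
    have hp0 : (0 : ℝ) < p := by exact_mod_cast hp.pos
    have hq0 : (0 : ℝ) < q := by exact_mod_cast hq.pos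
    refine ⟨p, q, p ^ 2 * q, hp, hq, hpq, rfl, ?_, axisWithInterval p q,
      isIncomplete_axisWithInterval hp.one_lt _, ?_, not_isNice_axisWithInterval hp _⟩
    · have hn : 1 < p ^ 2 * q := by nlinarith [hp.one_lt, hq.one_lt, Nat.one_le_pow 2 p hp.pos]
      have hlog : 0 < Real.log ((p ^ 2 * q : ℕ) : ℝ) := Real.log_pos (by exact_mod_cast hn)
      rw [one_div_mul_eq_div, le_div_iff₀ hD]
      refine Real.le_sqrt_of_sq_le ?_
      rw [le_div_iff₀ hlog]
      push_cast at h1 ⊢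
      calc ((p : ℝ) * p * D) ^ 2 * Real.log ((p : ℝ) ^ 2 * q)
          = (p : ℝ) ^ 2 * (p ^ 2 * D ^ 2 * Real.log ((p : ℝ) ^ 2 * q)) := by ring
        _ ≤ (p : ℝ) ^ 2 * q := by gcongr
    · rw [ncard_axisWithInterval hp.one_lt]
      have h3 : ((p ^ 2 * q : ℕ) : ℝ) / ((p : ℝ) * p) = q := by
        push_cast
        field_simp
      rw [h3]
      rw [Nat.cast_add, Nat.cast_sub hp.one_lt.le, Nat.cast_one]
      linarith
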